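/- Let $Y$ be an infinite-dimensional normed space over $\mathbb K=\mathbb R$ or $\mathbb C$ (not necessarily complete). A linear relation on $Y$ is a map $T$ assigning to each $x\in Y$ a nonempty set $T(x)\subset Y$ such that $T(ax+by)=aT(x)+bT(y)$ for all $x,y\in Y$ and all nonzero $a,b\in\mathbb K$; then $T(0)$ is a linear subspace. Put $(ST)(x)=\bigcup_{y\in T(x)}S(y)$, $(aS+bT)(x)=aS(x)+bT(x)$ and $T^{-1}(B)=\{x: T(x)\cap B\neq\emptyset\}$. Let $LR_0(Y)$ be the set of linear relations $T$ on $Y$ with $\dim T(0)<\infty$ that are continuous in the sense that $T^{-1}(B)$ is open for every open $B\subset Y$ (lower semicontinuity). A relation $T\in LR_0(Y)$ is compact if the single-valued operator $x\mapsto T(x)+T(0)\in Y/T(0)$ maps every bounded set into a compact set. A set of linear relations is a semialgebra if it is closed under composition and under linear combinations $af+bg$ with nonzero $a,b\in\mathbb K$. For a linear relation $h$ let $\mathrm{Comm}(h)$ be the set of all $f\in LR_0(Y)$ such that $hf(x)\subset fh(x)$ for all $x\in Y$. **Theorem (Weakly Invariant Subspaces).** Let $h$ be a linear relation on $Y$ (not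 necessarily continuous), let $G\subset\mathrm{Comm}(h)$ be a semialgebra, and let $k\in\mathrm{Comm}(h)$ be compact with $k^{-1}(0)=\{x: 0\in k(x)\}\neq Y$. Suppose that $h(0)\subset gk(0)$ for all $g\in G$. Then there is a closed linear subspace $M\subset Y$ with $M\neq\{0\}$ and $M\neq Y$ such that either 1. $M$ is $G$-invariant, that is, $g(x)\subset M$ for all $g\in G$ and $x\in M$; or 2. $M$ is finite-dimensional and $h$-weakly-invariant, that is, $h(x)\cap M\neq\emptyset$ for all $x\in M$. -/

import Mathlib

open scoped Pointwise

/-- A multivalued map `X → Y`, as a set-valued function, is a linear relation if its values are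
nonempty and `T (a x + b y) = a T x + b T y` for all nonzero scalars `a`, `b`. -/
structure IsLinearRelation (𝕜 : Type*) {X Y : Type*} [Field 𝕜] [AddCommGroup X] [Module 𝕜 X]
    [AddCommGroup Y] [Module 𝕜 Y] (T : X → Set Y) : Prop where
  nonempty : ∀ x, (T x).Nonempty
  map_comb : ∀ (x y : X) (a b : 𝕜), a ≠ 0 → b ≠ 0 → T (a • x + b • y) = a • T x + b • T y

/-- The composition `S T` of multivalued maps: `(S T) x` is the union of the `S y`, `y ∈ T x`. -/
def multiComp {X Y Z : Type*} (S : Y → Set Z) (T : X → Set Y) : X → Set Z :=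
  fun x => ⋃ y ∈ T x, S y

/-- The value `T 0` as a subspace of `Y`. For a linear relation `T` the set `T 0` is already a
subspace, so that taking the span adds nothing (`IsLinearRelation.coe_zeroValue`). -/
def zeroValue (𝕜 : Type*) {X Y : Type*} [Field 𝕜] [AddCommGroup X]
    [AddCommGroup Y] [Module 𝕜 Y] (T : X → Set Y) : Submodule 𝕜 Y :=
  Submodule.span 𝕜 (T 0)

theorem IsLinearRelation.coe_zeroValue {𝕜 X Y : Type*} [Field 𝕜] [AddCommGroup X] [Module 𝕜 X]
    [AddCommGroup Y] [Module 𝕜 Y] {T : X → Set Y} (hT : IsLinearRelation 𝕜 T) :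
    (zeroValue 𝕜 T : Set Y) = T 0 := by
  have key : ∀ (a b : 𝕜), a ≠ 0 → b ≠ 0 → ∀ u ∈ T 0, ∀ v ∈ T 0, a • u + b • v ∈ T 0 := by
    intro a b ha hb u hu v hv
    have h := hT.map_comb 0 0 a b ha hb
    rw [smul_zero, smul_zero, add_zero] at h
    rw [h]
    exact Set.add_mem_add (Set.smul_mem_smul_set hu) (Set.smul_mem_smul_set hv)
  have h0 : (0 : Y) ∈ T 0 := by
    obtain ⟨u, hu⟩ := hT.nonempty 0
    simpa using key 1 (-1) one_ne_zero (neg_ne_zero.mpr one_ne_zero) u hu u hu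
  refine Set.Subset.antisymm ?_ Submodule.subset_span
  intro u hu
  refine Submodule.span_induction (fun _ h => h) h0 ?_ ?_ hu
  · intro x y _ _ hx hy
    simpa using key 1 1 one_ne_zero one_ne_zero x hx y hy
  · intro a x _ hx
    by_cases ha : a = 0
    · simpa [ha] using h0
    · simpa using key a 1 ha one_ne_zero x hx 0 h0

/-- The class `LR₀(X, Y)`: continuous linear relations with finite-dimensional value at `0`.
Continuity is lower semicontinuity: `{x | T x ∩ B ≠ ∅}` is open for every open `B`. -/
structure IsLR0 (𝕜 : Type*) {X Y : Type*} [RCLike 𝕜] [NormedAddCommGroup X] [NormedSpace 𝕜 X]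
    [NormedAddCommGroup Y] [NormedSpace 𝕜 Y] (T : X → Set Y) : Prop where
  linear : IsLinearRelation 𝕜 T
  continuous : LowerHemicontinuous T
  finite_zero : FiniteDimensional 𝕜 (zeroValue 𝕜 T)

/-- `T` is compact: the operator `x ↦ T x + T 0` into the quotient of `Y` by `T 0` maps
every bounded set into a compact set. -/
def IsCompactRelation (𝕜 : Type*) {X Y : Type*} [RCLike 𝕜] [NormedAddCommGroup X]
    [NormedAddCommGroup Y] [NormedSpace 𝕜 Y] (T : X → Set Y) : Prop :=
  ∀ B : Set X, Bornology.IsBounded B →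
    ∃ D : Set (Y ⧸ zeroValue 𝕜 T), IsCompact D ∧ ∀ x ∈ B, ∀ y ∈ T x, (zeroValue 𝕜 T).mkQ y ∈ D

/-- A semialgebra of linear relations: a set of linear relations that is closed under nonzero
linear combinations and compositions. -/
structure IsSemialgebra (𝕜 : Type*) {Y : Type*} [Field 𝕜] [AddCommGroup Y] [Module 𝕜 Y]
    (G : Set (Y → Set Y)) : Prop where
  linear : ∀ g ∈ G, IsLinearRelation 𝕜 g
  comb_mem : ∀ f ∈ G, ∀ g ∈ G, ∀ a b : 𝕜, a ≠ 0 → b ≠ 0 → (fun x => a • f x + b • g x) ∈ G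
  comp_mem : ∀ f ∈ G, ∀ g ∈ G, multiComp f g ∈ G

/-- The commutant of `h`: all `f` in `LR₀(Y)` that commute with `h`, that is, `h f ⊆ f h`. -/
def Comm (𝕜 : Type*) {Y : Type*} [RCLike 𝕜] [NormedAddCommGroup Y] [NormedSpace 𝕜 Y]
    (h : Y → Set Y) : Set (Y → Set Y) :=
  {f | IsLR0 𝕜 f ∧ ∀ x, multiComp h f x ⊆ multiComp f h x}

/-- `M` is invariant under the family `G`: `g(M) ⊆ M` for all `g ∈ G`. -/
def IsInvariantUnder {𝕜 Y : Type*} [Field 𝕜] [AddCommGroup Y] [Module 𝕜 Y]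
    (G : Set (Y → Set Y)) (M : Submodule 𝕜 Y) : Prop :=
  ∀ g ∈ G, ∀ x ∈ M, g x ⊆ M

/-- `M` is `h`-weakly-invariant: `h x` meets `M` for all `x ∈ M`. -/
def IsWeaklyInvariant {𝕜 Y : Type*} [Field 𝕜] [AddCommGroup Y] [Module 𝕜 Y]
    (h : Y → Set Y) (M : Submodule 𝕜 Y) : Prop :=
  ∀ x ∈ M, (h x ∩ M).Nonempty

/-!
The proof is Lomonosov's fixed point argument, carried out for linear relations.

A relation in `LR₀` is a continuous linear operator up to the finite-dimensional subspace `T 0`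
(`IsLR0.exists_selection`), and for compact `k` this operator `κ` is compact. It is nonzero because
`k⁻¹ 0 ≠ Y`. The orbit `G x = ⋃ g x` of a vector under the semialgebra is a subspace, and by lower
semicontinuity its closure is `G`-invariant. So if there is no nontrivial closed `G`-invariant
subspace, then all orbits of nonzero vectors are dense (`IsSemialgebra.dense_orbit`).

In that case take a small ball `B` around a vector `x₀` with `κ x₀ ≠ 0`. Gluing selections of
members of `G` by a partition of unity gives a continuous `φ` on the compact set `closure (κ B)`
with `φ y ∈ G y ∩ B`. Schauder's theorem gives `x = φ (κ x)` in `B`, that is, a nonzero `x ∈ g k x`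
for some `g ∈ G` (`IsSemialgebra.exists_fixed_vector`). The vectors with `x ∈ g k x` form a subspace. It
is finite-dimensional by Riesz's theorem, because `x - γ κ x` lies in a fixed finite-dimensional
subspace when `γ` is a selection of `g`. It is weakly invariant under `h` because `h` commutes with
`g k` and `h 0 ⊆ g k 0` (`IsLinearRelation.isWeaklyInvariant_fixedVectors`).

Schauder's theorem is reduced to Brouwer's theorem by finite nets. Brouwer's theorem is proved by an
integration argument in the spirit of Milnor and Rogers. For a compactly supported `C¹` map `g`, the
maps `x + t g x` are diffeomorphisms for small `t`, so that the change of variables formula makes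
the integral of `φ (x + t g x) * det (1 + t g' x)` independent of `t`. For polynomial `φ` the integral
is polynomial in `t`, so this remains true at `t = 1` (`setIntegral_pow_mul_det`). Choosing for `φ` high
powers of a polynomial that peaks at `0` shows that `x + g x` vanishes somewhere
(`exists_add_eq_zero_of_contDiff`).
-/

/-! ### Brouwer's fixed point theorem -/

section Brouwer

open MeasureTheory Polynomial

theorem bijective_add_smul_of_lipschitzWith {E : Type*} [NormedAddCommGroup E] [NormedSpace ℝ E]
    [CompleteSpace E] {g : E → E} {K : NNReal} (hg : LipschitzWith K g) {t : ℝ}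
    (ht : |t| * K < 1) : Function.Bijective fun x => x + t • g x := by
  have hlip : ∀ y, ContractingWith (‖t‖₊ * K) fun x => y - t • g x := fun y => by
    refine ⟨by rw [← NNReal.coe_lt_coe]; simpa using ht, LipschitzWith.of_dist_le_mul fun a b => ?_⟩
    have := hg.dist_le_mul a b
    rw [dist_sub_left, dist_smul₀]
    simp only [NNReal.coe_mul, coe_nnnorm]
    nlinarith [norm_nonneg t]
  constructor
  · intro a b hab
    refine (hlip (a + t • g a)).fixedPoint_unique' (x := a) (y := b) ?_ ?_
    · simp [Function.IsFixedPt]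
    · have hab : a + t • g a = b + t • g b := hab
      simp [Function.IsFixedPt, hab]
  · intro y
    obtain ⟨x, hx⟩ := (hlip y).exists_fixedPoint 0 (edist_ne_top _ _)
    exact ⟨x, (sub_eq_iff_eq_add.1 (hx.1 : y - t • g x = x)).symm⟩

theorem det_id_add_smul_pos {E : Type*} [NormedAddCommGroup E] [NormedSpace ℝ E]
    [FiniteDimensional ℝ E] {A : E →L[ℝ] E} {t : ℝ} (ht : |t| * ‖A‖ < 1) :
    0 < (ContinuousLinearMap.id ℝ E + t • A).det := by
  have : CompleteSpace E := FiniteDimensional.complete ℝ E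
  -- The determinant is nonzero along the segment from `id` to `id + t A`.
  have hne : ∀ s ∈ Set.Icc (0 : ℝ) 1,
      (ContinuousLinearMap.id ℝ E + (s * t) • A).det ≠ 0 := fun s hs => by
    have hu : IsUnit (1 - (-((s * t) • A))) := by
      refine isUnit_one_sub_of_norm_lt_one ?_
      rw [norm_neg, norm_smul, norm_mul, Real.norm_eq_abs, Real.norm_eq_abs, abs_of_nonneg hs.1]
      nlinarith [mul_nonneg (abs_nonneg t) (norm_nonneg A), hs.1, hs.2]
    rw [sub_neg_eq_add] at hu
    have h2 := (hu.map (ContinuousLinearMap.toLinearMapRingHom (R₁ := ℝ) (M₁ := E))).map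
      (LinearMap.det : (E →ₗ[ℝ] E) →* ℝ)
    exact h2.ne_zero
  have hc : Continuous fun s : ℝ => (ContinuousLinearMap.id ℝ E + (s * t) • A).det := by
    refine ContinuousLinearMap.continuous_det.comp ?_
    fun_prop
  by_contra! hle
  obtain ⟨s, hs, h0⟩ := intermediate_value_Icc' zero_le_one hc.continuousOn
    (show (0 : ℝ) ∈ Set.Icc _ _ by
      constructor
      · simpa using hle
      · simp [ContinuousLinearMap.det])
  exact hne s hs h0

/-- The evaluation of a polynomial with coefficients in `C(E, ℝ)` at a point of `E` and a real
number. Such a polynomial stands for a family of real polynomials of bounded degree whose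
coefficients depend continuously on the point. -/
noncomputable def evalPoint {E : Type*} [TopologicalSpace E] (x : E) (t : ℝ) :
    C(E, ℝ)[X] →+* ℝ :=
  eval₂RingHom (ContinuousMap.evalAlgHom ℝ ℝ x : C(E, ℝ) →+* ℝ) t

theorem evalPoint_C {E : Type*} [TopologicalSpace E] (x : E) (t : ℝ) (f : C(E, ℝ)) :
    evalPoint x t (C f) = f x := by
  simp [evalPoint]

theorem evalPoint_X {E : Type*} [TopologicalSpace E] (x : E) (t : ℝ) :
    evalPoint x t (X : C(E, ℝ)[X]) = t := by
  simp [evalPoint]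

theorem evalPoint_eq_sum {E : Type*} [TopologicalSpace E] (x : E) (t : ℝ) (P : C(E, ℝ)[X]) :
    evalPoint x t P = ∑ n ∈ Finset.range (P.natDegree + 1), P.coeff n x * t ^ n := by
  simp [evalPoint, eval₂_eq_sum_range]

/-- Integrating a polynomial with continuous coefficients over a compact set gives a polynomial. -/
theorem exists_polynomial_setIntegral {E : Type*} [TopologicalSpace E] [T2Space E]
    [MeasurableSpace E] [OpensMeasurableSpace E] {μ : Measure E} [IsFiniteMeasureOnCompacts μ]
    {D : Set E} (hD : IsCompact D) (P : C(E, ℝ)[X]) :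
    ∃ p : ℝ[X], ∀ t, ∫ x in D, evalPoint x t P ∂μ = p.eval t := by
  refine ⟨∑ n ∈ Finset.range (P.natDegree + 1), C (∫ x in D, P.coeff n x ∂μ) * X ^ n, fun t => ?_⟩
  simp only [evalPoint_eq_sum, eval_finsetSum, eval_mul, eval_C, eval_pow, eval_X]
  rw [integral_finsetSum]
  · exact Finset.sum_congr rfl fun n _ => integral_mul_const _ _
  · intro n _
    exact ((P.coeff n).continuous.mul continuous_const).continuousOn.integrableOn_compact hD

/-- Let `g` be a compactly supported `C¹` map. For small `t` the map `x + t g x` is a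
diffeomorphism that preserves every large ball `D`, so the integral over `D` of
`φ (x + t g x) * det (1 + t g' x)` does not depend on `t`. For polynomial `φ` the integral is a
polynomial in `t`, so it is constant and the equality persists at `t = 1`, where the map need not
be injective. Here `φ` is a power of `1 - c ∑ i, (y i) ^ 2`. -/
theorem setIntegral_pow_mul_det {ι : Type*} [Fintype ι] [DecidableEq ι]
    {g : (ι → ℝ) → (ι → ℝ)} (hg : ContDiff ℝ 1 g) (hgc : HasCompactSupport g) {r : ℝ}
    (hr : ∀ x, r < ‖x‖ → g x = 0) (c : ℝ) (N : ℕ) :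
    ∫ x in Metric.closedBall 0 r, (1 - c * ∑ i, (x i + g x i) ^ 2) ^ N *
        (ContinuousLinearMap.id ℝ (ι → ℝ) + fderiv ℝ g x).det =
      ∫ x in Metric.closedBall (0 : ι → ℝ) r, (1 - c * ∑ i, (x i) ^ 2) ^ N := by
  set D := Metric.closedBall (0 : ι → ℝ) r with hD
  have hDc : IsCompact D := isCompact_closedBall _ _
  have hgd : Differentiable ℝ g := hg.differentiable one_ne_zero
  have hg' : Continuous (fderiv ℝ g) := hg.continuous_fderiv one_ne_zero
  obtain ⟨K, hK⟩ := hg.lipschitzWith_of_hasCompactSupport hgc one_ne_zero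
  let a : ι → ι → C(ι → ℝ, ℝ) := fun i j => ⟨fun x => fderiv ℝ g x (Pi.single j 1) i, by fun_prop⟩
  let y : ι → C(ι → ℝ, ℝ) := fun i => ⟨fun x => x i, by fun_prop⟩
  let b : ι → C(ι → ℝ, ℝ) := fun i => ⟨fun x => g x i, by
    have := hg.continuous
    fun_prop⟩
  let P : C(ι → ℝ, ℝ)[X] :=
    (1 - C (ContinuousMap.const _ c) * ∑ i, (C (y i) + X * C (b i)) ^ 2) ^ N *
      (1 + Matrix.of fun i j => X * C (a i j)).det
  have hP : ∀ x t, evalPoint x t P = (1 - c * ∑ i, (x i + t * g x i) ^ 2) ^ N *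
      (ContinuousLinearMap.id ℝ (ι → ℝ) + t • fderiv ℝ g x).det := fun x t => by
    simp only [P, map_mul, map_pow, map_sub, map_one, map_sum, map_add, evalPoint_C, evalPoint_X,
      RingHom.map_det]
    congr 1
    rw [ContinuousLinearMap.det, ← LinearMap.det_toMatrix']
    congr 1
    ext i j
    simp [LinearMap.toMatrix'_apply, Matrix.one_apply, Pi.single_apply, evalPoint_C, evalPoint_X, a]
    exact mul_comm _ _
  have hsmall : ∀ t : ℝ, |t| * K < 1 →
      ∫ x in D, evalPoint x t P = ∫ x in D, (1 - c * ∑ i, (x i) ^ 2) ^ N := fun t ht => by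
    have hbij := bijective_add_smul_of_lipschitzWith hK ht
    have himage : (fun x => x + t • g x) '' D = D := by
      have hout : ∀ x ∉ D, x + t • g x = x := fun x hx => by
        rw [hr x (by simpa [hD] using hx), smul_zero, add_zero]
      ext z
      constructor
      · rintro ⟨x, hx, rfl⟩
        by_contra hz
        have h1 := hout _ hz
        rw [hbij.1 h1] at hz
        exact hz hx
      · intro hz
        obtain ⟨x, rfl⟩ := hbij.2 z
        refine ⟨x, ?_, rfl⟩
        by_contra hx
        simp only [hout x hx] at hz
        exact hx hz
    have hcv := integral_image_eq_integral_abs_det_fderiv_smul volume hDc.measurableSet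
      (f := fun x => x + t • g x)
      (f' := fun x => ContinuousLinearMap.id ℝ (ι → ℝ) + t • fderiv ℝ g x)
      (fun x _ => ((hasFDerivAt_id x).add
        ((hgd x).hasFDerivAt.const_smul t)).hasFDerivWithinAt) hbij.1.injOn
      (fun z => (1 - c * ∑ i, (z i) ^ 2) ^ N)
    rw [himage] at hcv
    rw [hcv]
    refine integral_congr_ae (Filter.Eventually.of_forall fun x => ?_)
    simp only [hP]
    rw [abs_of_pos (det_id_add_smul_pos ?_), smul_eq_mul, mul_comm]
    · simp
    · refine lt_of_le_of_lt ?_ ht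
      gcongr
      exact norm_fderiv_le_of_lipschitz ℝ hK
  obtain ⟨p, hp⟩ := exists_polynomial_setIntegral (μ := volume) hDc P
  have hconst : p = C (∫ x in D, (1 - c * ∑ i, (x i) ^ 2) ^ N) := by
    refine Polynomial.eq_of_infinite_eval_eq _ _
      (Set.Infinite.mono (s := Set.Ioo 0 (1 / (K + 1 : ℝ)))
      (fun t ht => ?_) (Set.Ioo_infinite (by positivity)))
    simp only [Set.mem_ofPred_eq, eval_C]
    rw [← hp, hsmall]
    have hK0 : (0 : ℝ) ≤ K := K.2
    have h1 := ht.2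
    rw [lt_div_iff₀ (by positivity)] at h1
    rw [abs_of_pos ht.1]
    nlinarith [ht.1]
  have h1 := hp 1
  rw [hconst, eval_C] at h1
  simpa [hP] using h1

/-- For a compactly supported `C¹` map `g`, the map `x + g x` has a zero: otherwise the left-hand
side of `setIntegral_pow_mul_det`, where `1 - c ∑ i, (y i) ^ 2` is evaluated away from its maximum
`y = 0`, would decay faster in `N` than the right-hand side. -/
theorem exists_add_eq_zero_of_contDiff {ι : Type*} [Fintype ι]
    {g : (ι → ℝ) → (ι → ℝ)} (hg : ContDiff ℝ 1 g) (hgc : HasCompactSupport g) :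
    ∃ x, x + g x = 0 := by
  classical
  by_contra! hne
  obtain ⟨r₀, hr₀⟩ := hgc.isCompact.isBounded.subset_closedBall 0
  set r := max r₀ 1
  have hr : ∀ x, r < ‖x‖ → g x = 0 := fun x hx => by
    by_contra h
    have h1 : x ∈ Metric.closedBall 0 r₀ := hr₀ (subset_tsupport _ h)
    rw [mem_closedBall_zero_iff] at h1
    exact absurd hx (not_lt.2 (h1.trans (le_max_left _ _)))
  have hr0 : 0 < r := lt_of_lt_of_le one_pos (le_max_right _ _)
  set D := Metric.closedBall (0 : ι → ℝ) r with hD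
  have hDc : IsCompact D := isCompact_closedBall _ _
  have hDne : D.Nonempty := ⟨0, Metric.mem_closedBall_self hr0.le⟩
  have hgcont := hg.continuous
  have hg' : Continuous (fderiv ℝ g) := hg.continuous_fderiv one_ne_zero
  let S : (ι → ℝ) → ℝ := fun x => ∑ i, (x i) ^ 2
  have hS : Continuous S := by fun_prop
  have hS0 : ∀ x, 0 ≤ S x := fun x => Finset.sum_nonneg fun i _ => sq_nonneg _
  have hSpos : ∀ x, x ≠ 0 → 0 < S x := fun x hx => by
    obtain ⟨i, hi⟩ := Function.ne_iff.1 hx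
    exact Finset.sum_pos' (fun i _ => sq_nonneg _) ⟨i, Finset.mem_univ _, by
      have : x i ≠ 0 := hi
      positivity⟩
  have hSF : Continuous fun x => S (x + g x) := hS.comp (by fun_prop)
  obtain ⟨M₁, hM₁⟩ := hDc.exists_bound_of_continuousOn hS.continuousOn
  obtain ⟨M₂, hM₂⟩ := hDc.exists_bound_of_continuousOn hSF.continuousOn
  obtain ⟨x₁, hx₁, hmin⟩ := hDc.exists_isMinOn hDne hSF.continuousOn
  set m := S (x₁ + g x₁)
  have hm : 0 < m := hSpos _ (hne x₁)
  set M := max M₁ M₂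
  have hmM : m ≤ M := (Real.le_norm_self _).trans ((hM₂ x₁ hx₁).trans (le_max_right _ _))
  have hM : 0 < M := hm.trans_le hmM
  have hMi : M⁻¹ * M = 1 := inv_mul_cancel₀ hM.ne'
  have hMpos : 0 < M⁻¹ := inv_pos.2 hM
  set α := 1 - M⁻¹ * m with hα
  set β := 1 - M⁻¹ * (m / 2) with hβ
  have hα0 : 0 ≤ α := by nlinarith
  have hαβ : α < β := by nlinarith
  let J : (ι → ℝ) → ℝ := fun x => (ContinuousLinearMap.id ℝ (ι → ℝ) + fderiv ℝ g x).det
  have hJ : Continuous J := ContinuousLinearMap.continuous_det.comp (by fun_prop)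
  set L := ∫ x in D, |J x|
  set U : Set (ι → ℝ) := Metric.ball 0 r ∩ {x | S x < m / 2} with hU
  have hUo : IsOpen U := Metric.isOpen_ball.inter (isOpen_lt hS continuous_const)
  have hUD : U ⊆ D := fun x hx => Metric.ball_subset_closedBall hx.1
  set v := volume.real U
  have hv : 0 < v := by
    refine ENNReal.toReal_pos (hUo.measure_pos volume ⟨0, Metric.mem_ball_self hr0, ?_⟩).ne' ?_
    · simp [S, hm]
    · exact ((measure_mono hUD).trans_lt hDc.measure_lt_top).ne
  have hkey : ∀ N : ℕ, β ^ N * v ≤ α ^ N * L := fun N => by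
    have hint : IntegrableOn (fun x => (1 - M⁻¹ * S x) ^ N) D :=
      ContinuousOn.integrableOn_compact hDc (by fun_prop)
    calc β ^ N * v = ∫ _ in U, β ^ N := by simp [v, mul_comm]
      _ ≤ ∫ x in U, (1 - M⁻¹ * S x) ^ N := by
        refine setIntegral_mono_on ?_ (hint.mono_set hUD) hUo.measurableSet fun x hx => ?_
        · exact integrableOn_const ((measure_mono hUD).trans_lt hDc.measure_lt_top).ne
        · have : S x < m / 2 := hx.2
          refine pow_le_pow_left₀ (hα0.trans hαβ.le) ?_ N
          nlinarith
      _ ≤ ∫ x in D, (1 - M⁻¹ * S x) ^ N := by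
        refine setIntegral_mono_set hint ?_ hUD.eventuallyLE
        refine (ae_restrict_iff' hDc.measurableSet).2 (Filter.Eventually.of_forall fun x hx => ?_)
        have h1 : S x ≤ M := (Real.le_norm_self _).trans ((hM₁ x hx).trans (le_max_left _ _))
        refine pow_nonneg ?_ N
        nlinarith
      _ = ∫ x in D, (1 - M⁻¹ * S (x + g x)) ^ N * J x :=
        (setIntegral_pow_mul_det hg hgc hr M⁻¹ N).symm
      _ ≤ ∫ x in D, α ^ N * |J x| := by
        refine setIntegral_mono_on (ContinuousOn.integrableOn_compact hDc (by fun_prop))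
          (ContinuousOn.integrableOn_compact hDc (by fun_prop)) hDc.measurableSet fun x hx => ?_
        have h1 : S (x + g x) ≤ M :=
          (Real.le_norm_self _).trans ((hM₂ x hx).trans (le_max_right _ _))
        have h2 : m ≤ S (x + g x) := hmin hx
        have h3 : 0 ≤ 1 - M⁻¹ * S (x + g x) := by nlinarith
        have h4 : 1 - M⁻¹ * S (x + g x) ≤ α := by nlinarith
        exact (mul_le_mul_of_nonneg_left (le_abs_self _) (pow_nonneg h3 N)).trans
          (mul_le_mul_of_nonneg_right (pow_le_pow_left₀ h3 h4 N) (abs_nonneg _))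
      _ = α ^ N * L := integral_const_mul _ _
  have hβ0 : 0 < β := hα0.trans_lt hαβ
  have hL : 0 ≤ L := integral_nonneg fun x => abs_nonneg _
  obtain ⟨N, hN⟩ := exists_pow_lt_of_lt_one (show 0 < v / (L + 1) by positivity)
    ((div_lt_one hβ0).2 hαβ)
  rw [div_pow, div_lt_div_iff₀ (by positivity) (by positivity)] at hN
  have := hkey N
  have := pow_nonneg hα0 N
  nlinarith

/-- **Brouwer's fixed point theorem** for bounded continuous self-maps of `ℝⁿ`. -/
theorem exists_fixedPoint_of_bounded {ι : Type*} [Fintype ι] {f : (ι → ℝ) → (ι → ℝ)}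
    (hf : Continuous f) {R : ℝ} (hR : ∀ x, ‖f x‖ ≤ R) : ∃ x, f x = x := by
  by_contra! hne
  have hR0 : 0 ≤ R := (norm_nonneg _).trans (hR 0)
  -- The cutoff equals `1` on the ball of radius `R`, where all fixed points must lie.
  let χ : (ι → ℝ) → ℝ := fun x => max 0 (min 1 (R + 1 - ‖x‖))
  have hχ : Continuous χ := by fun_prop
  have hχ0 : ∀ x, 0 ≤ χ x := fun x => le_max_left _ _
  have hχ1 : ∀ x, χ x ≤ 1 := fun x => max_le zero_le_one (min_le_left _ _)
  let k : (ι → ℝ) → (ι → ℝ) := fun x => χ x • f x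
  have hk : Continuous k := hχ.smul hf
  have hkne : ∀ x, k x ≠ x := fun x hx => by
    have h1 : ‖x‖ ≤ R := by
      rw [← hx, norm_smul, Real.norm_of_nonneg (hχ0 x)]
      nlinarith [hR x, hχ0 x, hχ1 x, norm_nonneg (f x)]
    have h2 : χ x = 1 := by
      simp only [χ]
      rw [min_eq_left (by linarith), max_eq_right zero_le_one]
    exact hne x (by simpa [k, h2] using hx)
  have hkz : ∀ x ∉ Metric.closedBall (0 : ι → ℝ) (R + 1), k x = 0 := fun x hx => by
    have : R + 1 < ‖x‖ := by simpa using hx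
    have h2 : χ x = 0 := max_eq_left ((min_le_right _ _).trans (by linarith))
    simp [k, h2]
  have hpos : ∀ x, 0 < dist (k x) x := fun x => dist_pos.2 (hkne x)
  obtain ⟨g, hg, hgk, hgs⟩ := hk.exists_contDiff_approx 1 (hk.dist continuous_id) hpos
  have hgc : HasCompactSupport (-g) := by
    refine HasCompactSupport.intro (isCompact_closedBall (0 : ι → ℝ) (R + 1)) fun x hx => ?_
    have : g x = 0 := by
      by_contra h
      exact hgs h (hkz x hx)
    simp [this]
  obtain ⟨x, hx⟩ := exists_add_eq_zero_of_contDiff (g := -g) hg.neg hgc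
  have hxg : g x = x := by
    rw [Pi.neg_apply, add_neg_eq_zero] at hx
    exact hx.symm
  have := hgk x
  rw [hxg, dist_comm] at this
  exact lt_irrefl _ this

end Brouwer

/-! ### Schauder's fixed point theorem -/

/-- A continuous map of a convex set into a compact part of it has approximate fixed points. On a
finite `ε`-net of the compact set the partition of unity `W p a` proportional to
`max 0 (ε - dist a p)` turns `f` into a map of barycentric coordinates, to which Brouwer's theorem
applies. -/
theorem exists_dist_le_of_mapsTo_compact {E : Type*} [NormedAddCommGroup E] [NormedSpace ℝ E]
    {s A : Set E} (hs : Convex ℝ s) (hne : s.Nonempty) {f : E → E} (hf : ContinuousOn f s)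
    (hA : IsCompact A) (hAs : A ⊆ s) (hfA : Set.MapsTo f s A) {ε : ℝ} (hε : 0 < ε) :
    ∃ x ∈ s, dist (f x) x ≤ ε := by
  obtain ⟨t, htA, htfin, hcover⟩ := hA.finite_cover_balls hε
  have := htfin.fintype
  have hnear : ∀ a ∈ A, ∃ p : t, dist a p < ε := fun a ha => by
    obtain ⟨p, hp, hap⟩ := Set.mem_iUnion₂.1 (hcover ha)
    exact ⟨⟨p, hp⟩, hap⟩
  have : Nonempty t := by
    obtain ⟨x, hx⟩ := hne
    exact (hnear _ (hfA hx)).nonempty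
  let w : t → E → ℝ := fun p a => max 0 (ε - dist a p)
  have hw0 : ∀ p a, 0 ≤ w p a := fun p a => le_max_left _ _
  have hwc : ∀ p, Continuous (w p) := fun p => by fun_prop
  have hwpos : ∀ a ∈ A, 0 < ∑ p, w p a := fun a ha => by
    obtain ⟨p, hp⟩ := hnear a ha
    exact Finset.sum_pos' (fun p _ => hw0 p a)
      ⟨p, Finset.mem_univ _, lt_max_of_lt_right (sub_pos.2 hp)⟩
  let W : t → E → ℝ := fun p a => w p a / ∑ q, w q a
  have hW0 : ∀ p a, 0 ≤ W p a := fun p a =>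
    div_nonneg (hw0 p a) (Finset.sum_nonneg fun q _ => hw0 q a)
  have hW1 : ∀ a ∈ A, ∑ p, W p a = 1 := fun a ha => by
    simp only [W]
    rw [← Finset.sum_div, div_self (hwpos a ha).ne']
  -- These weights are nonnegative with positive sum, and equal to the coordinates on the
  -- standard simplex.
  let c : (t → ℝ) → t → ℝ := fun v p => |v p| + max 0 (1 - ∑ q, |v q|)
  have hc0 : ∀ v p, 0 ≤ c v p := fun v p => add_nonneg (abs_nonneg _) (le_max_left _ _)
  have hcpos : ∀ v, 0 < ∑ p, c v p := fun v => by
    simp only [c, Finset.sum_add_distrib]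
    rcases lt_or_ge (∑ q, |v q|) 1 with h | h
    · refine add_pos_of_nonneg_of_pos (Finset.sum_nonneg fun p _ => abs_nonneg _) ?_
      exact Finset.sum_pos (fun p _ => lt_max_of_lt_right (sub_pos.2 h)) Finset.univ_nonempty
    · exact add_pos_of_pos_of_nonneg (one_pos.trans_le h)
        (Finset.sum_nonneg fun p _ => le_max_left _ _)
  let P : (t → ℝ) → E := fun v => Finset.univ.centerMass (c v) fun p : t => (p : E)
  have hPs : ∀ v, P v ∈ s := fun v =>
    hs.centerMass_mem (fun p _ => hc0 v p) (hcpos v) fun p _ => hAs (htA p.2)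
  have hPc : Continuous P := by
    have hcc : ∀ p, Continuous fun v => c v p := fun p => by fun_prop
    refine Continuous.smul (Continuous.inv₀ (by fun_prop) fun v => (hcpos v).ne') ?_
    fun_prop
  have hfPc : Continuous fun v => f (P v) := hf.comp_continuous hPc hPs
  have hfP : ∀ v, f (P v) ∈ A := fun v => hfA (hPs v)
  obtain ⟨v, hv⟩ := exists_fixedPoint_of_bounded (f := fun v p => W p (f (P v))) (R := 1)
    (continuous_pi fun p => ((hwc p).comp hfPc).div
      (continuous_finsetSum _ fun q _ => (hwc q).comp hfPc) fun v => (hwpos _ (hfP v)).ne')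
    (fun v => (pi_norm_le_iff_of_nonneg zero_le_one).2 fun p => by
      rw [Real.norm_of_nonneg (hW0 _ _), ← hW1 _ (hfP v)]
      exact Finset.single_le_sum (f := fun p => W p (f (P v))) (fun q _ => hW0 q _)
        (Finset.mem_univ p))
  have hvp : ∀ p, v p = W p (f (P v)) := fun p => (congrFun hv p).symm
  have hv1 : ∑ p, v p = 1 := by
    rw [← hW1 _ (hfP v)]
    exact Finset.sum_congr rfl fun p _ => hvp p
  have hcv : c v = v := by
    have habs : ∀ p, |v p| = v p := fun p => abs_of_nonneg (hvp p ▸ hW0 _ _)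
    ext p
    simp [c, habs, hv1]
  have hPv : P v = ∑ p, v p • (p : E) := by
    simp only [P]
    rw [hcv, Finset.centerMass_eq_of_sum_1 _ _ hv1]
  refine ⟨P v, hPs v, ?_⟩
  -- Only net points within `ε` of `f (P v)` have nonzero weight.
  have hsum : ∑ p, v p • (p : E) = ∑ p with v p ≠ 0, v p • (p : E) := by
    rw [Finset.sum_filter]
    refine Finset.sum_congr rfl fun p _ => ?_
    by_cases h : v p = 0 <;> simp [h]
  have hmem : ∑ p with v p ≠ 0, v p • (p : E) ∈ Metric.closedBall (f (P v)) ε := by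
    refine (convex_closedBall _ _).sum_mem (fun p _ => hvp p ▸ hW0 _ _) ?_ fun p hp => ?_
    · rw [Finset.sum_filter_ne_zero, hv1]
    · have h1 : v p ≠ 0 := (Finset.mem_filter.1 hp).2
      rw [Metric.mem_closedBall, dist_comm]
      by_contra! h2
      have : w p (f (P v)) = 0 := max_eq_left (by linarith)
      exact h1 (by simp [hvp p, W, this])
  rw [← hsum, ← hPv, Metric.mem_closedBall, dist_comm] at hmem
  exact hmem

/-- **Schauder's fixed point theorem**. -/
theorem exists_fixedPoint_of_mapsTo_compact {E : Type*} [NormedAddCommGroup E] [NormedSpace ℝ E]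
    {s A : Set E} (hs : Convex ℝ s) (hne : s.Nonempty) {f : E → E} (hf : ContinuousOn f s)
    (hA : IsCompact A) (hAs : A ⊆ s) (hfA : Set.MapsTo f s A) : ∃ x ∈ s, f x = x := by
  choose x hxs hx using fun n : ℕ => exists_dist_le_of_mapsTo_compact hs hne hf hA hAs hfA
    (Nat.one_div_pos_of_nat (α := ℝ) (n := n))
  obtain ⟨a, haA, φ, hφ, hlim⟩ := hA.tendsto_subseq fun n => hfA (hxs n)
  have hdist : Filter.Tendsto (fun n => dist (f (x (φ n))) (x (φ n))) Filter.atTop (nhds 0) :=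
    squeeze_zero (fun _ => dist_nonneg) (fun n => hx (φ n))
      (tendsto_one_div_add_atTop_nhds_zero_nat.comp hφ.tendsto_atTop)
  have hxlim : Filter.Tendsto (fun n => x (φ n)) Filter.atTop (nhds a) :=
    hlim.congr_dist hdist
  have hfx : Filter.Tendsto (fun n => f (x (φ n))) Filter.atTop (nhds (f a)) :=
    (hf a (hAs haA)).tendsto.comp
      (tendsto_nhdsWithin_iff.2 ⟨hxlim, Filter.Eventually.of_forall fun n => hxs _⟩)
  exact ⟨a, hAs haA, tendsto_nhds_unique hfx hlim⟩

/-! ### Linear relations -/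

theorem IsLinearRelation.zero_mem {𝕜 X Y : Type*} [Field 𝕜] [AddCommGroup X] [Module 𝕜 X]
    [AddCommGroup Y] [Module 𝕜 Y] {T : X → Set Y} (hT : IsLinearRelation 𝕜 T) :
    (0 : Y) ∈ T 0 := by
  rw [← hT.coe_zeroValue]
  exact Submodule.zero_mem _

theorem IsLinearRelation.comb_mem {𝕜 X Y : Type*} [Field 𝕜] [AddCommGroup X] [Module 𝕜 X]
    [AddCommGroup Y] [Module 𝕜 Y] {T : X → Set Y} (hT : IsLinearRelation 𝕜 T)
    {x y : X} {u v : Y} {a b : 𝕜} (ha : a ≠ 0) (hb : b ≠ 0) (hu : u ∈ T x) (hv : v ∈ T y) :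
    a • u + b • v ∈ T (a • x + b • y) := by
  rw [hT.map_comb x y a b ha hb]
  exact Set.add_mem_add (Set.smul_mem_smul_set hu) (Set.smul_mem_smul_set hv)

theorem IsLinearRelation.add_mem {𝕜 X Y : Type*} [Field 𝕜] [AddCommGroup X] [Module 𝕜 X]
    [AddCommGroup Y] [Module 𝕜 Y] {T : X → Set Y} (hT : IsLinearRelation 𝕜 T)
    {x y : X} {u v : Y} (hu : u ∈ T x) (hv : v ∈ T y) : u + v ∈ T (x + y) := by
  simpa using hT.comb_mem (one_ne_zero' 𝕜) (one_ne_zero' 𝕜) hu hv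

theorem IsLinearRelation.sub_mem {𝕜 X Y : Type*} [Field 𝕜] [AddCommGroup X] [Module 𝕜 X]
    [AddCommGroup Y] [Module 𝕜 Y] {T : X → Set Y} (hT : IsLinearRelation 𝕜 T)
    {x y : X} {u v : Y} (hu : u ∈ T x) (hv : v ∈ T y) : u - v ∈ T (x - y) := by
  simpa [sub_eq_add_neg] using
    hT.comb_mem (one_ne_zero' 𝕜) (neg_ne_zero.mpr (one_ne_zero' 𝕜)) hu hv

theorem IsLinearRelation.smul_mem {𝕜 X Y : Type*} [Field 𝕜] [AddCommGroup X] [Module 𝕜 X]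
    [AddCommGroup Y] [Module 𝕜 Y] {T : X → Set Y} (hT : IsLinearRelation 𝕜 T)
    {x : X} {u : Y} (a : 𝕜) (hu : u ∈ T x) : a • u ∈ T (a • x) := by
  rcases eq_or_ne a 0 with rfl | ha
  · simpa using hT.zero_mem
  · simpa using hT.comb_mem ha (one_ne_zero' 𝕜) hu hT.zero_mem

/-- A continuous linear relation with finite-dimensional value at `0` has a continuous linear
selection, and its values are the translates of `T 0` by that selection. The selection is
`(1 - P) ∘ T`, where `P` is a continuous projection onto the finite-dimensional subspace `T 0`;
such a projection exists by Hahn–Banach, without completeness. The factor map `q = 1 - P` is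
recorded because compactness of `T` is stated in the quotient by `T 0`. -/
theorem IsLR0.exists_selection {𝕜 X Y : Type*} [RCLike 𝕜] [NormedAddCommGroup X]
    [NormedSpace 𝕜 X] [NormedAddCommGroup Y] [NormedSpace 𝕜 Y] {T : X → Set Y}
    (hT : IsLR0 𝕜 T) :
    ∃ (t : X →L[𝕜] Y) (q : Y →L[𝕜] Y), (∀ x y, y ∈ T x ↔ y - t x ∈ zeroValue 𝕜 T) ∧
      (∀ y ∈ zeroValue 𝕜 T, q y = 0) ∧ ∀ x, ∀ y ∈ T x, t x = q y := by
  have := hT.finite_zero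
  have hL := hT.linear
  have hmem : ∀ y, y ∈ zeroValue 𝕜 T ↔ y ∈ T 0 := fun y => by
    rw [← hL.coe_zeroValue, SetLike.mem_coe]
  obtain ⟨P, hP⟩ := Submodule.ClosedComplemented.of_finiteDimensional (𝕜 := 𝕜) (zeroValue 𝕜 T)
  set q : Y →L[𝕜] Y := ContinuousLinearMap.id 𝕜 Y - (zeroValue 𝕜 T).subtypeL.comp P with hq
  have hq0 : ∀ y ∈ zeroValue 𝕜 T, q y = 0 := fun y hy => by
    simp [hq, hP ⟨y, hy⟩]
  have hqs : ∀ y, y - q y ∈ zeroValue 𝕜 T := fun y => by simp [hq]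
  choose s hs using hL.nonempty
  have hsq : ∀ x, ∀ y ∈ T x, q (s x) = q y := fun x y hy => by
    rw [← sub_eq_zero, ← map_sub]
    refine hq0 _ ((hmem _).2 ?_)
    simpa using hL.sub_mem (hs x) hy
  let tl : X →ₗ[𝕜] Y :=
    { toFun := fun x => q (s x)
      map_add' := fun x y => by
        rw [← map_add]; exact hsq _ _ (hL.add_mem (hs x) (hs y))
      map_smul' := fun a x => by
        rw [RingHom.id_apply, ← map_smul]; exact hsq _ _ (hL.smul_mem a (hs x)) }
  have htl : ∀ x, tl x = q (s x) := fun _ => rfl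
  have hcont : Continuous tl := by
    refine continuous_def.2 fun U hU => ?_
    have := lowerHemicontinuous_iff_isOpen_inter_nonempty.1 hT.continuous _
      (hU.preimage q.continuous)
    convert this using 1
    ext x
    constructor
    · intro hx
      exact ⟨s x, hs x, hx⟩
    · rintro ⟨y, hy, hyU⟩
      change q (s x) ∈ U
      rw [hsq x y hy]
      exact hyU
  refine ⟨⟨tl, hcont⟩, q, fun x y => ⟨fun hy => ?_, fun hy => ?_⟩, hq0, hsq⟩
  · change y - q (s x) ∈ _
    rw [hsq x y hy]
    exact hqs y
  · change y - q (s x) ∈ _ at hy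
    have h1 : y - s x ∈ zeroValue 𝕜 T := by
      have := sub_mem hy (hqs (s x))
      simpa using this
    simpa using hL.add_mem (hs x) ((hmem _).1 h1)

/-- The selection of a compact relation is a compact operator. -/
theorem IsLR0.exists_compact_selection {𝕜 X Y : Type*} [RCLike 𝕜] [NormedAddCommGroup X]
    [NormedSpace 𝕜 X] [NormedAddCommGroup Y] [NormedSpace 𝕜 Y] {T : X → Set Y}
    (hT : IsLR0 𝕜 T) (hc : IsCompactRelation 𝕜 T) :
    ∃ t : X →L[𝕜] Y, (∀ x y, y ∈ T x ↔ y - t x ∈ zeroValue 𝕜 T) ∧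
      ∀ B : Set X, Bornology.IsBounded B → ∃ C : Set Y, IsCompact C ∧ Set.MapsTo t B C := by
  obtain ⟨t, q, ht, hq0, htq⟩ := hT.exists_selection
  refine ⟨t, ht, fun B hB => ?_⟩
  obtain ⟨D, hD, hBD⟩ := hc B hB
  let q' : (Y ⧸ zeroValue 𝕜 T) →ₗ[𝕜] Y := (zeroValue 𝕜 T).liftQ q.toLinearMap hq0
  have hq' : Continuous q' := by
    refine (zeroValue 𝕜 T).isQuotientMap_mkQ.continuous_iff.2 ?_
    exact q.continuous
  refine ⟨q' '' D, hD.image hq', fun x hx => ?_⟩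
  obtain ⟨y, hy⟩ := hT.linear.nonempty x
  exact ⟨_, hBD x hx y hy, (htq x y hy).symm⟩

/-! ### Orbits of a semialgebra -/

/-- The orbit of `x` under a nonempty semialgebra `G`, the union of all `g x`, as a subspace. -/
def IsSemialgebra.orbit {𝕜 Y : Type*} [Field 𝕜] [AddCommGroup Y] [Module 𝕜 Y]
    {G : Set (Y → Set Y)} (hG : IsSemialgebra 𝕜 G) (hne : G.Nonempty) (x : Y) :
    Submodule 𝕜 Y where
  carrier := {u | ∃ g ∈ G, u ∈ g x}
  add_mem' := by
    rintro u v ⟨f, hf, hu⟩ ⟨g, hg, hv⟩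
    refine ⟨_, hG.comb_mem f hf g hg 1 1 one_ne_zero one_ne_zero, ?_⟩
    exact Set.add_mem_add ⟨u, hu, one_smul _ _⟩ ⟨v, hv, one_smul _ _⟩
  zero_mem' := by
    obtain ⟨g, hg⟩ := hne
    obtain ⟨u, hu⟩ := (hG.linear g hg).nonempty x
    refine ⟨_, hG.comb_mem g hg g hg 1 (-1) one_ne_zero (neg_ne_zero.2 one_ne_zero), ?_⟩
    exact ⟨u, ⟨u, hu, one_smul _ _⟩, -u, ⟨u, hu, by simp⟩, by simp⟩
  smul_mem' := by
    rintro a u ⟨g, hg, hu⟩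
    rcases eq_or_ne a 0 with rfl | ha
    · refine ⟨_, hG.comb_mem g hg g hg 1 (-1) one_ne_zero (neg_ne_zero.2 one_ne_zero), ?_⟩
      exact ⟨u, ⟨u, hu, one_smul _ _⟩, -u, ⟨u, hu, by simp⟩, by simp⟩
    · -- Multiples are only available inside combinations of two relations, so `a g` is replaced by
      -- `(a g + a g) - a g`, whose values contain those of `a g`.
      refine ⟨_, hG.comb_mem _ (hG.comb_mem g hg g hg a a ha ha) g hg 1 (-a) one_ne_zero
        (neg_ne_zero.2 ha), ?_⟩
      exact ⟨a • u + a • u, ⟨_, Set.add_mem_add (Set.smul_mem_smul_set hu)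
        (Set.smul_mem_smul_set hu), one_smul _ _⟩, -(a • u), ⟨u, hu, by simp⟩, by simp⟩

theorem IsSemialgebra.isInvariantUnder_orbit {𝕜 Y : Type*} [Field 𝕜] [AddCommGroup Y]
    [Module 𝕜 Y] {G : Set (Y → Set Y)} (hG : IsSemialgebra 𝕜 G) (hne : G.Nonempty) (x : Y) :
    IsInvariantUnder G (hG.orbit hne x) := by
  rintro f hf u ⟨g, hg, hu⟩ v hv
  exact ⟨_, hG.comp_mem f hf g hg, Set.mem_biUnion hu hv⟩

/-- Lower semicontinuity passes invariance from a subspace to its closure. -/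
theorem IsInvariantUnder.topologicalClosure {𝕜 Y : Type*} [RCLike 𝕜] [NormedAddCommGroup Y]
    [NormedSpace 𝕜 Y] {G : Set (Y → Set Y)} {M : Submodule 𝕜 Y} (hM : IsInvariantUnder G M)
    (hG : ∀ g ∈ G, LowerHemicontinuous g) : IsInvariantUnder G M.topologicalClosure := by
  intro g hg x hx y hy
  change y ∈ closure (M : Set Y)
  refine mem_closure_iff.2 fun V hV hyV => ?_
  have hopen := lowerHemicontinuous_iff_isOpen_inter_nonempty.1 (hG g hg) V hV
  obtain ⟨z, ⟨v, hv, hvV⟩, hzM⟩ := mem_closure_iff.1 hx _ hopen ⟨y, hy, hyV⟩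
  exact ⟨v, hvV, hM g hg z hzM hv⟩

/-- If no nontrivial closed subspace is `G`-invariant, then the orbits of nonzero vectors are
dense. -/
theorem IsSemialgebra.dense_orbit {𝕜 Y : Type*} [RCLike 𝕜] [NormedAddCommGroup Y]
    [NormedSpace 𝕜 Y] (hY : ¬ FiniteDimensional 𝕜 Y) {G : Set (Y → Set Y)}
    (hG : IsSemialgebra 𝕜 G) (hne : G.Nonempty) (hGc : ∀ g ∈ G, LowerHemicontinuous g)
    (hinv : ∀ M : Submodule 𝕜 Y, IsClosed (M : Set Y) → IsInvariantUnder G M → M = ⊥ ∨ M = ⊤)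
    {x : Y} (hx : x ≠ 0) : Dense (hG.orbit hne x : Set Y) := by
  rcases hinv _ (Submodule.isClosed_topologicalClosure _)
    ((hG.isInvariantUnder_orbit hne x).topologicalClosure hGc) with hbot | htop
  · -- If the orbit of `x` is trivial, then the line spanned by `x` is invariant.
    exfalso
    have hzero : ∀ g ∈ G, ∀ u ∈ g x, u = 0 := fun g hg u hu => by
      have : u ∈ (hG.orbit hne x).topologicalClosure :=
        Submodule.le_topologicalClosure _ ⟨g, hg, hu⟩
      simpa [hbot] using this
    have hspan : IsInvariantUnder G (𝕜 ∙ x) := by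
      intro g hg y hy v hv
      obtain ⟨u, hu⟩ := (hG.linear g hg).nonempty x
      obtain ⟨a, rfl⟩ := Submodule.mem_span_singleton.1 hy
      have h1 := (hG.linear g hg).add_mem ((hG.linear g hg).smul_mem (1 - a) hu) hv
      rw [← add_smul, sub_add_cancel, one_smul, hzero g hg u hu, smul_zero, zero_add] at h1
      rw [hzero g hg v h1]
      exact zero_mem _
    rcases hinv _ (Submodule.closed_of_finiteDimensional _) hspan with h | h
    · exact hx (Submodule.span_singleton_eq_bot.1 h)
    · refine hY (Module.finite_def.2 ?_)
      rw [← h]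
      exact Submodule.fg_span_singleton x
  · exact Submodule.dense_iff_topologicalClosure_eq_top.2 htop

/-! ### Fixed vectors of `g k` -/

/-- Lomonosov's lemma for semialgebras: if the orbits of nonzero vectors are dense and `κ` is a
nonzero compact operator, then some `g κ` has a nonzero fixed vector. On a small ball `B` away
from `0` whose image under `κ` also stays away from `0`, a continuous map `φ` with
`φ y ∈ G y ∩ B` is glued by a partition of unity (the orbits are convex), and Schauder's theorem
applies to `φ ∘ κ`. -/
theorem IsSemialgebra.exists_fixed_vector {𝕜 Y : Type*} [RCLike 𝕜] [NormedAddCommGroup Y]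
    [NormedSpace 𝕜 Y] {G : Set (Y → Set Y)}
    (hG : IsSemialgebra 𝕜 G) (hne : G.Nonempty) (hGc : ∀ g ∈ G, IsLR0 𝕜 g)
    (hdense : ∀ x : Y, x ≠ 0 → Dense (hG.orbit hne x : Set Y))
    {κ : Y →L[𝕜] Y} (hκ0 : κ ≠ 0)
    (hκ : ∀ B : Set Y, Bornology.IsBounded B → ∃ C : Set Y, IsCompact C ∧ Set.MapsTo κ B C) :
    ∃ x : Y, x ≠ 0 ∧ ∃ g ∈ G, x ∈ g (κ x) := by
  let _ : NormedSpace ℝ Y := NormedSpace.restrictScalars ℝ 𝕜 Y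
  obtain ⟨x₀, hx₀⟩ : ∃ x₀, κ x₀ ≠ 0 := by
    by_contra! h
    exact hκ0 (ContinuousLinearMap.ext h)
  have hx₀' : x₀ ≠ 0 := by
    rintro rfl
    exact hx₀ (map_zero κ)
  obtain ⟨δ, hδ, hδκ⟩ := Metric.continuousAt_iff.1 (κ.continuous.continuousAt (x := x₀))
    (‖κ x₀‖ / 2) (by positivity)
  set r := min (δ / 2) (‖x₀‖ / 2) with hr
  have hr0 : 0 < r := by
    have := norm_pos_iff.2 hx₀'
    positivity
  set B := Metric.closedBall x₀ r with hB
  obtain ⟨D, hD, hBD⟩ := hκ B Metric.isBounded_closedBall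
  set C := closure (κ '' B) with hC
  have hCc : IsCompact C :=
    hD.of_isClosed_subset isClosed_closure (closure_minimal hBD.image_subset hD.isClosed)
  have hC0 : (0 : Y) ∉ C := by
    intro h0
    have hsub : κ '' B ⊆ Metric.closedBall (κ x₀) (‖κ x₀‖ / 2) := by
      rintro _ ⟨x, hx, rfl⟩
      refine (hδκ ?_).le
      have : dist x x₀ ≤ r := hx
      have : r ≤ δ / 2 := min_le_left _ _
      linarith
    have := closure_minimal hsub Metric.isClosed_closedBall h0
    rw [Metric.mem_closedBall, dist_zero_left] at this
    have := norm_pos_iff.2 hx₀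
    linarith
  have : CompactSpace C := isCompact_iff_compactSpace.1 hCc
  obtain ⟨φ, hφ⟩ := exists_continuous_forall_mem_convex_of_local
    (t := fun y : C => (hG.orbit hne (y : Y) : Set Y) ∩ B) (fun y => by
      refine Convex.inter ?_ (convex_closedBall _ _)
      exact ((hG.orbit hne (y : Y)).restrictScalars ℝ).convex) (fun y => by
      -- If `u ∈ g y` is interior to `B`, then translating the selection of `g` so that it takes
      -- the value `u` at `y` gives a local section.
      obtain ⟨u, ⟨g, hg, hu⟩, huB⟩ := (hdense y fun h => hC0 (h ▸ y.2)).exists_mem_open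
        Metric.isOpen_ball ⟨x₀, Metric.mem_ball_self hr0⟩
      obtain ⟨γ, -, hγ, -⟩ := (hGc g hg).exists_selection
      have hcont : Continuous fun z : C => γ z + (u - γ y) := by fun_prop
      refine ⟨_, (Metric.isOpen_ball.preimage hcont).mem_nhds (?_ : y ∈ _ ⁻¹' Metric.ball x₀ r),
        _, hcont.continuousOn, fun z hz => ⟨⟨g, hg, ?_⟩, Metric.ball_subset_closedBall hz⟩⟩
      · simpa using huB
      · refine (hγ _ _).2 ?_
        simpa using (hγ _ _).1 hu)
  have hmem : ∀ x ∈ B, κ x ∈ C := fun x hx => subset_closure ⟨x, hx, rfl⟩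
  obtain ⟨x, hxB, hx⟩ := exists_fixedPoint_of_mapsTo_compact (s := B) (A := Set.range φ)
    (f := Function.extend Subtype.val φ 0 ∘ κ)
    (convex_closedBall _ _) ⟨x₀, Metric.mem_closedBall_self hr0.le⟩
    (by
      refine ContinuousOn.comp (t := C) ?_ κ.continuous.continuousOn hmem
      rw [continuousOn_iff_continuous_domRestrict]
      convert φ.continuous using 1
      ext y
      exact Subtype.val_injective.extend_apply _ _ _)
    (isCompact_range φ.continuous) (by rintro _ ⟨y, rfl⟩; exact (hφ y).2)
    (fun x hx => ⟨⟨κ x, hmem x hx⟩, (Subtype.val_injective.extend_apply φ 0 ⟨κ x, hmem x hx⟩).symm⟩)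
  have hx' : φ ⟨κ x, hmem x hxB⟩ = x :=
    (Subtype.val_injective.extend_apply φ 0 ⟨κ x, hmem x hxB⟩).symm.trans hx
  refine ⟨x, ?_, ?_⟩
  · rintro rfl
    have h1 : dist 0 x₀ ≤ r := hxB
    have h2 : r ≤ ‖x₀‖ / 2 := min_le_right _ _
    rw [dist_zero_left] at h1
    have := norm_pos_iff.2 hx₀'
    linarith
  · have := (hφ ⟨κ x, hmem x hxB⟩).1
    rw [hx'] at this
    exact this

/-- The vectors fixed by a linear relation, `{x | x ∈ T x}`, as a subspace. -/
def IsLinearRelation.fixedVectors {𝕜 Y : Type*} [Field 𝕜] [AddCommGroup Y] [Module 𝕜 Y]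
    {T : Y → Set Y} (hT : IsLinearRelation 𝕜 T) : Submodule 𝕜 Y where
  carrier := {x | x ∈ T x}
  add_mem' := fun hx hy => hT.add_mem hx hy
  zero_mem' := hT.zero_mem
  smul_mem' := fun a _ hx => hT.smul_mem a hx

theorem IsLinearRelation.multiComp {𝕜 X Y Z : Type*} [Field 𝕜] [AddCommGroup X] [Module 𝕜 X]
    [AddCommGroup Y] [Module 𝕜 Y] [AddCommGroup Z] [Module 𝕜 Z] {S : Y → Set Z} {T : X → Set Y}
    (hS : IsLinearRelation 𝕜 S) (hT : IsLinearRelation 𝕜 T) :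
    IsLinearRelation 𝕜 (multiComp S T) where
  nonempty x := by
    obtain ⟨y, hy⟩ := hT.nonempty x
    obtain ⟨z, hz⟩ := hS.nonempty y
    exact ⟨z, Set.mem_biUnion hy hz⟩
  map_comb x y a b ha hb := by
    ext z
    simp only [_root_.multiComp, Set.mem_iUnion, exists_prop]
    constructor
    · rintro ⟨w, hw, hz⟩
      rw [hT.map_comb x y a b ha hb] at hw
      obtain ⟨_, ⟨u, hu, rfl⟩, _, ⟨v, hv, rfl⟩, rfl⟩ := hw
      simp only [hS.map_comb u v a b ha hb] at hz
      obtain ⟨_, ⟨p, hp, rfl⟩, _, ⟨q, hq, rfl⟩, rfl⟩ := hz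
      exact ⟨_, ⟨p, Set.mem_biUnion hu hp, rfl⟩, _, ⟨q, Set.mem_biUnion hv hq, rfl⟩, rfl⟩
    · rintro ⟨_, ⟨p, hp, rfl⟩, _, ⟨q, hq, rfl⟩, rfl⟩
      simp only [Set.mem_iUnion, exists_prop] at hp hq
      obtain ⟨u, hu, hp⟩ := hp
      obtain ⟨v, hv, hq⟩ := hq
      exact ⟨_, hT.comb_mem ha hb hu hv, hS.comb_mem ha hb hp hq⟩

/-- A compact perturbation of the identity, `1 - κ`, has finite-dimensional kernel, so the
preimage of a finite-dimensional subspace is finite-dimensional. -/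
theorem finiteDimensional_of_sub_apply_mem {𝕜 Y : Type*} [RCLike 𝕜] [NormedAddCommGroup Y]
    [NormedSpace 𝕜 Y] {κ : Y →L[𝕜] Y} {N F : Submodule 𝕜 Y} [FiniteDimensional 𝕜 N]
    (hκ : ∀ B : Set Y, Bornology.IsBounded B → ∃ C : Set Y, IsCompact C ∧ Set.MapsTo κ B C)
    (hF : ∀ x ∈ F, x - κ x ∈ N) : FiniteDimensional 𝕜 F := by
  set T : Y →L[𝕜] Y := ContinuousLinearMap.id 𝕜 Y - κ with hT
  have hker : FiniteDimensional 𝕜 (LinearMap.ker T.toLinearMap) := by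
    refine FiniteDimensional.of_isCompact_closedBall₀ 𝕜 one_pos ?_
    obtain ⟨C, hC, hBC⟩ := hκ (Metric.closedBall 0 1) Metric.isBounded_closedBall
    have hclosed : IsClosed ((LinearMap.ker T.toLinearMap : Submodule 𝕜 Y) : Set Y) :=
      T.isClosed_ker
    refine Topology.IsInducing.subtypeVal.isCompact_iff.2 ?_
    refine hC.of_isClosed_subset
      (hclosed.isClosedMap_subtype_val _ Metric.isClosed_closedBall) ?_
    rintro _ ⟨x, hx, rfl⟩
    have hx0 : (x : Y) - κ x = 0 := x.2
    have : (x : Y) ∈ Metric.closedBall (0 : Y) 1 := by simpa using hx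
    rw [sub_eq_zero.1 hx0]
    exact hBC this
  have hN : (F.map T.toLinearMap) ≤ N := by
    rintro _ ⟨x, hx, rfl⟩
    exact hF x hx
  have h1 : FiniteDimensional 𝕜 (F.map T.toLinearMap) := Submodule.finiteDimensional_of_le hN
  have h2 : FiniteDimensional 𝕜 (F ⊓ LinearMap.ker T.toLinearMap : Submodule 𝕜 Y) :=
    Submodule.finiteDimensional_of_le inf_le_right
  exact Module.Finite.iff_fg.2 (Submodule.fg_of_fg_map_of_fg_inf_ker T.toLinearMap
    (Module.Finite.iff_fg.1 h1) (Module.Finite.iff_fg.1 h2))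

/-- The fixed vectors of `g k`, with `k` compact, form a finite-dimensional subspace. -/
theorem IsLR0.finiteDimensional_fixedVectors {𝕜 Y : Type*} [RCLike 𝕜] [NormedAddCommGroup Y]
    [NormedSpace 𝕜 Y] {g k : Y → Set Y} (hg : IsLR0 𝕜 g) (hk : IsLR0 𝕜 k)
    (hc : IsCompactRelation 𝕜 k) :
    FiniteDimensional 𝕜 (hg.linear.multiComp hk.linear).fixedVectors := by
  obtain ⟨κ, hκ, hκc⟩ := hk.exists_compact_selection hc
  obtain ⟨γ, -, hγ, -⟩ := hg.exists_selection
  have := hg.finite_zero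
  have := hk.finite_zero
  refine finiteDimensional_of_sub_apply_mem (κ := γ.comp κ)
    (N := zeroValue 𝕜 g ⊔ (zeroValue 𝕜 k).map γ.toLinearMap) (fun B hB => ?_) fun x hx => ?_
  · obtain ⟨C, hC, hBC⟩ := hκc B hB
    exact ⟨γ '' C, hC.image γ.continuous, fun x hx => ⟨_, hBC hx, rfl⟩⟩
  · obtain ⟨y, hy, hxy⟩ := Set.mem_iUnion₂.1 (show x ∈ multiComp g k x from hx)
    have h1 := (hκ _ _).1 hy
    have h2 := (hγ _ _).1 hxy
    refine Submodule.mem_sup.2 ⟨_, h2, _, ⟨_, h1, rfl⟩, ?_⟩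
    simp

/-- If `h` commutes with `f` and `h 0 ⊆ f 0`, then the fixed vectors of `f` are weakly invariant
under `h`: an element of `h x` lies in `f y` for some `y ∈ h x`, and then `y ∈ f y`, because both
elements of `h x` differ by an element of `h 0`. -/
theorem IsLinearRelation.isWeaklyInvariant_fixedVectors {𝕜 Y : Type*} [Field 𝕜] [AddCommGroup Y]
    [Module 𝕜 Y] {f h : Y → Set Y} (hf : IsLinearRelation 𝕜 f) (hh : IsLinearRelation 𝕜 h)
    (hcomm : ∀ x, _root_.multiComp h f x ⊆ _root_.multiComp f h x) (hzero : h 0 ⊆ f 0) :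
    IsWeaklyInvariant h hf.fixedVectors := by
  intro x hx
  obtain ⟨z, hz⟩ := hh.nonempty x
  obtain ⟨y, hy, hzy⟩ := Set.mem_iUnion₂.1 (hcomm x (Set.mem_biUnion hx hz))
  refine ⟨y, hy, ?_⟩
  have h0 : y - z ∈ f 0 := hzero (by simpa using hh.sub_mem hy hz)
  change y ∈ f y
  simpa using hf.add_mem hzy h0

theorem mainTheorem2 {𝕜 Y : Type*} [RCLike 𝕜] [NormedAddCommGroup Y] [NormedSpace 𝕜 Y]
    (hY : ¬ FiniteDimensional 𝕜 Y)
    (h : Y → Set Y) (hh : IsLinearRelation 𝕜 h)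
    (G : Set (Y → Set Y)) (hG : IsSemialgebra 𝕜 G) (hGh : G ⊆ Comm 𝕜 h)
    (k : Y → Set Y) (hk : k ∈ Comm 𝕜 h) (hk_compact : IsCompactRelation 𝕜 k)
    (hk_ne : {x | (0 : Y) ∈ k x} ≠ Set.univ)
    (hzero : ∀ g ∈ G, h 0 ⊆ multiComp g k 0) :
    ∃ M : Submodule 𝕜 Y, M ≠ ⊥ ∧ M ≠ ⊤ ∧ IsClosed (M : Set Y) ∧
      (IsInvariantUnder G M ∨ (FiniteDimensional 𝕜 M ∧ IsWeaklyInvariant h M)) := by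
  have hfin : ∀ M : Submodule 𝕜 Y, FiniteDimensional 𝕜 M → M ≠ ⊤ := by
    rintro _ hM rfl
    exact hY (Module.finite_def.2 (Module.Finite.iff_fg.1 hM))
  obtain ⟨κ, hκ, hκc⟩ := hk.1.exists_compact_selection hk_compact
  have hκ0 : κ ≠ 0 := by
    rintro rfl
    exact hk_ne (Set.eq_univ_of_forall fun x => (hκ x 0).2 (by simp))
  rcases G.eq_empty_or_nonempty with rfl | hne
  · obtain ⟨x, hx⟩ : ∃ x, κ x ≠ 0 := by
      by_contra! h
      exact hκ0 (ContinuousLinearMap.ext h)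
    refine ⟨𝕜 ∙ x, ?_, hfin _ inferInstance, Submodule.closed_of_finiteDimensional _,
      Or.inl fun g hg => hg.elim⟩
    rw [Ne, Submodule.span_singleton_eq_bot]
    rintro rfl
    exact hx (map_zero κ)
  by_contra! hcon
  have hdense : ∀ x : Y, x ≠ 0 → Dense (hG.orbit hne x : Set Y) := fun x hx =>
    hG.dense_orbit hY hne (fun g hg => (hGh hg).1.continuous) (fun M hMc hMi => by
      by_contra! hM
      exact (hcon M hM.1 hM.2 hMc).1 hMi) hx
  obtain ⟨x, hx0, g, hg, hx⟩ :=
    hG.exists_fixed_vector hne (fun g hg => (hGh hg).1) hdense hκ0 hκc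
  have hgk := (hGh hg).1.linear.multiComp hk.1.linear
  have hF : FiniteDimensional 𝕜 hgk.fixedVectors :=
    (hGh hg).1.finiteDimensional_fixedVectors hk.1 hk_compact
  refine (hcon hgk.fixedVectors ?_ (hfin _ hF) (Submodule.closed_of_finiteDimensional _)).2 hF ?_
  · refine (Submodule.ne_bot_iff _).2 ⟨x, ?_, hx0⟩
    exact Set.mem_biUnion ((hκ x (κ x)).2 (by simp)) hx
  · refine hgk.isWeaklyInvariant_fixedVectors hh (fun x z hz => ?_) (hzero g hg)
    obtain ⟨w, hw, hz⟩ := Set.mem_iUnion₂.1 hz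
    obtain ⟨y, hy, hw⟩ := Set.mem_iUnion₂.1 hw
    obtain ⟨p, hp, hz⟩ := Set.mem_iUnion₂.1 ((hGh hg).2 y (Set.mem_biUnion hw hz))
    obtain ⟨q, hq, hp⟩ := Set.mem_iUnion₂.1 (hk.2 x (Set.mem_biUnion hy hp))
    exact Set.mem_biUnion hq (Set.mem_biUnion hp hz)
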